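/- Setting. In a multi-player multi-armed bandit (MPMAB) instance with $M$ players and $K$ arms, each player $p$ and arm $i$ has a reward distribution on $[0,1]$ with mean $\mu_i^p$; it is an $\epsilon$-MPMAB instance if $|\mu_i^p-\mu_i^q|\le\epsilon$ for all players $p,q$ and arms $i$. For a horizon $T>\max(M,K)$, in each round $t=1,\dots,T$ all players simultaneously pull an arm, each receives an independent reward from the corresponding distribution, and all pulls and rewards are then shared. An algorithm gives, for each horizon $T$ and each round, a conditional distribution of the joint action of all players given the history of all players. Its expected collective regret is $\mathbb E[\mathcal R(T)]=\sum_{p}\sum_{i}\Delta_i^p\,\mathbb E[n_i^p(T)]$, where $\Delta_i^p=\max_j\mu_j^p-\mu_i^p$ and $n_i^p(T)$ is the number of pulls of arm $i$ by player $p$ in the $T$ rounds. The algorithm has sublinear regret for the $\epsilon$-MPMAB problem, with constants $C,\alpha>0$, if $\mathbb E[\mathcal R(T)]\le C\,T^{1-\alpha}$ for all $T$ and all $\epsilon$-MPMAB instances (with the given $M$ and $K$). Ind-UCB is the algorithm in which each player runs UCB-1 on its own observations only: after $t$ rounds it pulls an arm that it has not pulled yet, if there is one, and otherwise an arm maximizing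 (empirical mean) $+\sqrt{2\ln t/n}$, where $n$ is the number of its pulls of that arm (ties are broken in favour of the smallest label). Claim. Let $0<\epsilon<\frac18$ and $0<\delta\le\frac{\epsilon}{4}$, and consider the instance with $M$ players and $K=2$ arms in which all rewards are Bernoulli and $\mu_1^p=\frac12+\delta$, $\mu_2^p=\frac12$ for every player $p$. Then every algorithm with sublinear regret for the $\epsilon$-MPMAB problem has regret $\Omega\!\left(\frac{M\ln T}{\delta}\right)$ on this instance, and this matches the regret of Ind-UCB. Precisely: (1) There is a universal constant $c>0$ such that for all $C,\alpha,\delta>0$ there is $T_0$, depending only on $C,\alpha,\delta$, such that for all $\epsilon\in(0,\frac18)$ with $\delta\le\frac\epsilon4$, all $M$, and every algorithm that has sublinear regret for the $\epsilon$-MPMAB problem (with $M$ players and two arms) with constants $C,\alpha$, its regret on the above instance satisfies $\mathbb E[\mathcal R(T)]\ge c\,\alpha\,\frac{M\ln T}{\delta}$ for all $T\ge T_0$ with $T>\max(M,2)$. (2) There is a universal constant $c'>0$ such that for all such $\epsilon,\delta$, all $M$ and all $T>\max(M,2)$, the regret of Ind-UCB on the above instance satisfies $\mathbb E[\mathcal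 R(T)]\le c'\,\frac{M\ln T}{\delta}$. -/

import Mathlib

open MeasureTheory ProbabilityTheory

namespace MPMAB

/-- A multi-player multi-armed bandit instance with `M` players and `K` arms: every player `p` and
arm `i` has a reward distribution on `ℝ` that is concentrated on `[0, 1]`. -/
structure Instance (M K : ℕ) where
  dist : Fin M → Fin K → Measure ℝ
  isProbabilityMeasure : ∀ p i, IsProbabilityMeasure (dist p i)
  mem_Icc : ∀ p i, ∀ᵐ x ∂(dist p i), x ∈ Set.Icc (0 : ℝ) 1

attribute [instance] Instance.isProbabilityMeasure

section Basic

variable {M K : ℕ}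

/-- The mean reward of arm `i` for player `p`. -/
noncomputable def Instance.mean (I : Instance M K) (p : Fin M) (i : Fin K) : ℝ :=
  ∫ x, x ∂(I.dist p i)

/-- The suboptimality gap of arm `i` for player `p`. -/
noncomputable def Instance.gap (I : Instance M K) (p : Fin M) (i : Fin K) : ℝ :=
  (⨆ j, I.mean p j) - I.mean p i

/-- `ε`-MPMAB instances: mean rewards of the same arm differ by at most `ε` between players. -/
def Instance.IsDissimilarity (I : Instance M K) (ε : ℝ) : Prop :=
  ∀ p q i, |I.mean p i - I.mean q i| ≤ ε

/-- The Bernoulli instance with mean rewards `μ`. -/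
noncomputable def bernoulliInstance (μ : Fin M → Fin K → unitInterval) : Instance M K where
  dist p i := bernoulliMeasure (1 : ℝ) 0 (μ p i)
  isProbabilityMeasure p i := inferInstance
  mem_Icc p i := by
    rw [ae_iff]
    exact bernoulliMeasure_apply_of_notMem_of_notMem _ measurableSet_Icc.compl (by simp) (by simp)

end Basic

/-- The joint action of the `M` players in one round. -/
abbrev Action (M K : ℕ) : Type := Fin M → Fin K

/-- The history of `t` rounds: in every round, the arms pulled and the rewards received by all
players. -/
abbrev Hist (M K t : ℕ) : Type := Fin t → Action M K × (Fin M → ℝ)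

/-- A (randomized) bandit learning algorithm: for every `t`, the conditional distribution of the
joint action in the next round given the history of the first `t` rounds. When it is run with
horizon `T`, only the policies with `t < T` are used. -/
structure Algorithm (M K : ℕ) where
  policy : (t : ℕ) → Kernel (Hist M K t) (Action M K)
  isMarkovKernel : ∀ t, IsMarkovKernel (policy t)

attribute [instance] Algorithm.isMarkovKernel

section Interaction

variable {M K : ℕ}

/-- Given the joint action `a`, the rewards of the players are independent, and the reward of
player `p` is drawn from the distribution of arm `a p`. -/
noncomputable def Instance.rewardKernel (I : Instance M K) : Kernel (Action M K) (Fin M → ℝ) :=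
  Kernel.ofFunOfCountable fun a => Measure.pi fun p => I.dist p (a p)

/-- The law of the history of the first `t` rounds. -/
noncomputable def Algorithm.law (A : Algorithm M K) (I : Instance M K) :
    (t : ℕ) → Measure (Hist M K t)
  | 0 => Measure.dirac Fin.elim0
  | t + 1 => ((A.law I t) ⊗ₘ (A.policy t ⊗ₖ Kernel.prodMkLeft (Hist M K t) I.rewardKernel)).map
      fun x => Fin.snoc (α := fun _ => Action M K × (Fin M → ℝ)) x.1 x.2

/-- The number of pulls of arm `i` by player `p`. -/
def pullCount {t : ℕ} (h : Hist M K t) (p : Fin M) (i : Fin K) : ℕ :=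
  ∑ s, if (h s).1 p = i then 1 else 0

/-- The total reward that player `p` received from arm `i`. -/
noncomputable def rewardSum {t : ℕ} (h : Hist M K t) (p : Fin M) (i : Fin K) : ℝ :=
  ∑ s, if (h s).1 p = i then (h s).2 p else 0

/-- The expected collective regret after `T` rounds. -/
noncomputable def Algorithm.regret (A : Algorithm M K) (I : Instance M K) (T : ℕ) : ℝ :=
  ∑ p, ∑ i, I.gap p i * ∫ h, (pullCount h p i : ℝ) ∂(A.law I T)

/-- Sublinear regret for the `ε`-MPMAB problem with constants `C` and `α`, where `A T` is the
algorithm used for horizon `T`: the regret is at most `C * T ^ (1 - α)` for every horizon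
`T > max M K` and every `ε`-MPMAB instance. -/
def SublinearRegretWith (C α ε : ℝ) (A : ℕ → Algorithm M K) : Prop :=
  0 < C ∧ 0 < α ∧ ∀ T : ℕ, max M K < T → ∀ I : Instance M K, I.IsDissimilarity ε →
    (A T).regret I T ≤ C * (T : ℝ) ^ (1 - α)

end Interaction

section IndUCB

variable {M K : ℕ}

lemma measurableSet_pull {t : ℕ} (s : Fin t) (p : Fin M) (i : Fin K) :
    MeasurableSet {h : Hist M K t | (h s).1 p = i} := by
  have : Measurable fun h : Hist M K t => (h s).1 p := by fun_prop
  exact this (measurableSet_singleton i)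

lemma measurable_pullCount {t : ℕ} (p : Fin M) (i : Fin K) :
    Measurable fun h : Hist M K t => pullCount h p i :=
  Finset.measurable_fun_sum _ fun s _ =>
    Measurable.ite (measurableSet_pull s p i) measurable_const measurable_const

lemma measurable_rewardSum {t : ℕ} (p : Fin M) (i : Fin K) :
    Measurable fun h : Hist M K t => rewardSum h p i :=
  Finset.measurable_fun_sum _ fun s _ =>
    Measurable.ite (measurableSet_pull s p i) (by fun_prop) measurable_const

/-- The UCB-1 index of arm `i` for player `p` after `t` rounds, computed from the pulls of player
`p` alone; it is infinite for an arm that the player has not pulled yet. -/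
noncomputable def ucbIndex {t : ℕ} (h : Hist M K t) (p : Fin M) (i : Fin K) : EReal :=
  if pullCount h p i = 0 then ⊤
  else ((rewardSum h p i / pullCount h p i + √(2 * Real.log t / pullCount h p i) : ℝ) : EReal)

lemma measurable_ucbIndex {t : ℕ} (p : Fin M) (i : Fin K) :
    Measurable fun h : Hist M K t => ucbIndex h p i := by
  have h1 := measurable_pullCount (M := M) (K := K) (t := t) p i
  have h2 := measurable_rewardSum (M := M) (K := K) (t := t) p i
  have h3 : Measurable fun h : Hist M K t => (pullCount h p i : ℝ) :=
    measurable_from_top.comp h1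
  refine Measurable.ite (h1 (measurableSet_singleton 0)) measurable_const ?_
  exact ((h2.div h3).add (measurable_const.div h3).sqrt).coe_real_ereal

open scoped Classical in
lemma argmax_nonempty [NeZero K] (f : Fin K → EReal) :
    (Finset.univ.filter fun i => ∀ j, f j ≤ f i).Nonempty := by
  obtain ⟨i, -, hi⟩ := Finset.exists_max_image Finset.univ f ⟨0, Finset.mem_univ _⟩
  exact ⟨i, by simpa using hi⟩

open scoped Classical in
/-- The arm that UCB-1 pulls for player `p`: the first one with maximal index. -/
noncomputable def ucbArm [NeZero K] {t : ℕ} (h : Hist M K t) (p : Fin M) : Fin K :=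
  (Finset.univ.filter fun i => ∀ j, ucbIndex h p j ≤ ucbIndex h p i).min' (argmax_nonempty _)

lemma ucbArm_eq_iff [NeZero K] {t : ℕ} (h : Hist M K t) (p : Fin M) (i : Fin K) :
    ucbArm h p = i ↔ (∀ j, ucbIndex h p j ≤ ucbIndex h p i) ∧
      ∀ k, (∀ j, ucbIndex h p j ≤ ucbIndex h p k) → i ≤ k := by
  classical
  unfold ucbArm
  rw [Finset.min'_eq_iff]
  simp

lemma measurable_ucbArm [NeZero K] {t : ℕ} :
    Measurable fun (h : Hist M K t) (p : Fin M) => ucbArm h p := by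
  refine measurable_pi_lambda _ fun p => measurable_to_countable' fun i => ?_
  have h1 : ∀ k : Fin K,
      MeasurableSet {h : Hist M K t | ∀ j, ucbIndex h p j ≤ ucbIndex h p k} := fun k => by
    rw [Set.ofPred_forall]
    exact MeasurableSet.iInter fun j =>
      measurableSet_le (measurable_ucbIndex p j) (measurable_ucbIndex p k)
  have h2 : (fun h : Hist M K t => ucbArm h p) ⁻¹' {i} =
      {h | ∀ j, ucbIndex h p j ≤ ucbIndex h p i} ∩
        ⋂ k, ({h | ∀ j, ucbIndex h p j ≤ ucbIndex h p k}ᶜ ∪ {_h | i ≤ k}) := by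
    ext h
    simp only [Set.mem_preimage, Set.mem_singleton_iff, ucbArm_eq_iff, Set.mem_inter_iff,
      Set.mem_iInter, Set.mem_union, Set.mem_compl_iff, Set.mem_ofPred_eq, imp_iff_not_or]
  rw [h2]
  exact (h1 i).inter (MeasurableSet.iInter fun k => (h1 k).compl.union (MeasurableSet.const _))

/-- Ind-UCB: every player runs UCB-1 on its own observations, without communication. -/
noncomputable def indUCB (M K : ℕ) [NeZero K] : Algorithm M K where
  policy _ := Kernel.deterministic (fun h p => ucbArm h p) measurable_ucbArm
  isMarkovKernel _ := inferInstance

end IndUCB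

end MPMAB

namespace MPMAB

/-! ### Laws of histories: Wald's identity, exponential supermartingales, change of measure. -/

section Law

variable {M K : ℕ}

/-! Lower bound. Fix a player `p` and raise the mean of arm `1` from 1/2 to 1/2 + 2δ for `p` alone.
The result is still an ε-instance, since 2δ ≤ ε/2, but arm `1` now beats arm `0` by δ for `p`. The
data of the other players have the same reward distributions in both instances, so sharing them does
not help: the log-likelihood ratio of the histories is a sum over the pulls of arm `1` by `p`
(`lintegral_law_change`). By Wald's identity (`integral_statSum`) its mean under the original
instance is at least -16δ² n, where n is the expected number of these pulls. Sublinear regret makes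
n small in the original instance and the expected number of pulls of arm `0` by `p` small in the
altered one. `mul_exp_le_pullCount_add` turns this into T exp(-16δ² n - 1) ≤ 2C T^(1-α)/δ, and
logarithms give n of order α ln T/δ². Each pull costs δ; summing over players gives the bound.

Upper bound. This is the UCB-1 analysis for each player separately. After about 8 ln T/δ² pulls of
arm `1`, pulling it again requires a violated confidence bound (`mem_deviation_of_ucbArm_eq`). An
exponential supermartingale and a union bound over the number of pulls make a violation after t
rounds have probability at most t · t⁻⁴ (`law_deviation_le_sum`), which is summable. -/

lemma measurable_snoc {t : ℕ} : Measurable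
    fun x : Hist M K t × (Action M K × (Fin M → ℝ)) =>
      (Fin.snoc (α := fun _ => Action M K × (Fin M → ℝ)) x.1 x.2 : Hist M K (t + 1)) := by
  refine measurable_pi_lambda _ fun s => ?_
  induction s using Fin.lastCases with
  | last => simpa using measurable_snd
  | cast s =>
    simp only [Fin.snoc_castSucc]
    exact (measurable_pi_apply s).comp measurable_fst

/-- The history `h` extended by the round `x`. -/
def extend {t : ℕ} (h : Hist M K t) (x : Action M K × (Fin M → ℝ)) : Hist M K (t + 1) :=
  Fin.snoc (α := fun _ => Action M K × (Fin M → ℝ)) h x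

lemma measurable_extend {t : ℕ} : Measurable
    fun x : Hist M K t × (Action M K × (Fin M → ℝ)) => extend x.1 x.2 := measurable_snoc

instance (I : Instance M K) : IsMarkovKernel I.rewardKernel :=
  ⟨fun a => inferInstanceAs (IsProbabilityMeasure (Measure.pi fun p => I.dist p (a p)))⟩

lemma Instance.rewardKernel_apply (I : Instance M K) (a : Action M K) :
    I.rewardKernel a = Measure.pi fun p => I.dist p (a p) := rfl

/-- The conditional law of the next round given the history. -/
noncomputable def Algorithm.step (A : Algorithm M K) (I : Instance M K) (t : ℕ) :
    Kernel (Hist M K t) (Action M K × (Fin M → ℝ)) :=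
  A.policy t ⊗ₖ Kernel.prodMkLeft (Hist M K t) I.rewardKernel

instance (A : Algorithm M K) (I : Instance M K) (t : ℕ) : IsMarkovKernel (A.step I t) := by
  unfold Algorithm.step
  infer_instance

lemma Algorithm.law_succ (A : Algorithm M K) (I : Instance M K) (t : ℕ) :
    A.law I (t + 1) = ((A.law I t) ⊗ₘ A.step I t).map fun x => extend x.1 x.2 := rfl

instance Algorithm.isProbabilityMeasure_law (A : Algorithm M K) (I : Instance M K) (t : ℕ) :
    IsProbabilityMeasure (A.law I t) := by
  induction t with
  | zero => exact inferInstanceAs (IsProbabilityMeasure (Measure.dirac _))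
  | succ t ih =>
    rw [A.law_succ]
    exact Measure.isProbabilityMeasure_map measurable_extend.aemeasurable

variable (A : Algorithm M K) (I : Instance M K)

lemma lintegral_law_succ {t : ℕ} {f : Hist M K (t + 1) → ENNReal} (hf : Measurable f) :
    ∫⁻ h, f h ∂A.law I (t + 1) = ∫⁻ h, ∫⁻ x, f (extend h x) ∂A.step I t h ∂A.law I t := by
  rw [A.law_succ, lintegral_map hf measurable_extend,
    Measure.lintegral_compProd (f := fun x => f (extend x.1 x.2)) (hf.comp measurable_extend)]

lemma lintegral_step {t : ℕ} (h : Hist M K t) {f : Action M K × (Fin M → ℝ) → ENNReal}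
    (hf : Measurable f) :
    ∫⁻ x, f x ∂A.step I t h = ∫⁻ a, ∫⁻ r, f (a, r) ∂I.rewardKernel a ∂A.policy t h := by
  unfold Algorithm.step
  rw [Kernel.lintegral_compProd _ _ _ hf]
  simp

lemma integral_law_succ {t : ℕ} {f : Hist M K (t + 1) → ℝ} (hf : Measurable f) {B : ℝ}
    (hB : ∀ h, |f h| ≤ B) :
    ∫ h, f h ∂A.law I (t + 1) = ∫ h, ∫ x, f (extend h x) ∂A.step I t h ∂A.law I t := by
  rw [A.law_succ, integral_map measurable_extend.aemeasurable hf.aestronglyMeasurable,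
    Measure.integral_compProd]
  exact .of_bound (hf.comp measurable_extend).aestronglyMeasurable B (.of_forall fun x => hB _)

lemma integral_step {t : ℕ} (h : Hist M K t) {f : Action M K × (Fin M → ℝ) → ℝ}
    (hf : Measurable f) {B : ℝ} (hB : ∀ x, |f x| ≤ B) :
    ∫ x, f x ∂A.step I t h = ∫ a, ∫ r, f (a, r) ∂I.rewardKernel a ∂A.policy t h := by
  unfold Algorithm.step
  rw [ProbabilityTheory.integral_compProd]
  · simp
  exact .of_bound hf.aestronglyMeasurable B (.of_forall hB)

/-- The sum of `g` over the rewards that player `p` received from arm `i`. -/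
noncomputable def statSum (g : ℝ → ℝ) {t : ℕ} (h : Hist M K t) (p : Fin M) (i : Fin K) : ℝ :=
  ∑ s, if (h s).1 p = i then g ((h s).2 p) else 0

lemma statSum_extend (g : ℝ → ℝ) {t : ℕ} (h : Hist M K t) (x : Action M K × (Fin M → ℝ))
    (p : Fin M) (i : Fin K) :
    statSum g (extend h x) p i = statSum g h p i + if x.1 p = i then g (x.2 p) else 0 := by
  simp [statSum, extend, Fin.sum_univ_castSucc]

lemma measurable_roundStat {g : ℝ → ℝ} (hg : Measurable g) (p : Fin M) (i : Fin K) :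
    Measurable fun x : Action M K × (Fin M → ℝ) => if x.1 p = i then g (x.2 p) else 0 := by
  have h1 : Measurable fun x : Action M K × (Fin M → ℝ) => x.1 p := by fun_prop
  exact Measurable.ite (h1 (measurableSet_singleton i)) (hg.comp (by fun_prop)) measurable_const

lemma statSum_zero (g : ℝ → ℝ) (h : Hist M K 0) (p : Fin M) (i : Fin K) :
    statSum g h p i = 0 := by
  simp [statSum]

lemma pullCount_extend {t : ℕ} (h : Hist M K t) (x : Action M K × (Fin M → ℝ))
    (p : Fin M) (i : Fin K) :
    pullCount (extend h x) p i = pullCount h p i + if x.1 p = i then 1 else 0 := by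
  simp [pullCount, extend, Fin.sum_univ_castSucc]

lemma pullCount_zero (h : Hist M K 0) (p : Fin M) (i : Fin K) : pullCount h p i = 0 := by
  simp [pullCount]

lemma pullCount_le {t : ℕ} (h : Hist M K t) (p : Fin M) (i : Fin K) : pullCount h p i ≤ t := by
  calc pullCount h p i ≤ ∑ _s : Fin t, 1 := Finset.sum_le_sum fun s _ => by split_ifs <;> simp
    _ = t := by simp

lemma measurable_statSum {g : ℝ → ℝ} (hg : Measurable g) {t : ℕ} (p : Fin M) (i : Fin K) :
    Measurable fun h : Hist M K t => statSum g h p i :=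
  Finset.measurable_fun_sum _ fun s _ =>
    Measurable.ite (measurableSet_pull s p i) (hg.comp (by fun_prop)) measurable_const

lemma abs_statSum_le {g : ℝ → ℝ} {B : ℝ} (hg : ∀ x, |g x| ≤ B) {t : ℕ} (h : Hist M K t)
    (p : Fin M) (i : Fin K) : |statSum g h p i| ≤ t * B := by
  have hB : 0 ≤ B := (abs_nonneg _).trans (hg 0)
  refine (Finset.abs_sum_le_sum_abs _ _).trans ?_
  calc _ ≤ ∑ _s : Fin t, B := Finset.sum_le_sum fun s _ => by split_ifs <;> simp [hg, hB]
    _ = t * B := by simp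

lemma integrable_pullCount {t : ℕ} (p : Fin M) (i : Fin K) :
    Integrable (fun h : Hist M K t => (pullCount h p i : ℝ)) (A.law I t) := by
  refine .of_bound (measurable_from_top.comp (measurable_pullCount p i)).aestronglyMeasurable t
    (.of_forall fun h => ?_)
  simpa using pullCount_le h p i

lemma integrable_statSum {g : ℝ → ℝ} (hg : Measurable g) {B : ℝ} (hB : ∀ x, |g x| ≤ B) {t : ℕ}
    (p : Fin M) (i : Fin K) :
    Integrable (fun h : Hist M K t => statSum g h p i) (A.law I t) :=
  .of_bound (measurable_statSum hg p i).aestronglyMeasurable _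
    (.of_forall fun h => abs_statSum_le hB h p i)

/-- Wald's identity for the observations of arm `i` by player `p`. -/
lemma integral_statSum {g : ℝ → ℝ} (hg : Measurable g) {B : ℝ} (hB : ∀ x, |g x| ≤ B) (t : ℕ)
    (p : Fin M) (i : Fin K) :
    ∫ h, statSum g h p i ∂A.law I t
      = (∫ x, g x ∂I.dist p i) * ∫ h, (pullCount h p i : ℝ) ∂A.law I t := by
  set m := ∫ x, g x ∂I.dist p i with hm
  have hB0 : 0 ≤ B := (abs_nonneg _).trans (hB 0)
  have hgm : Measurable fun x => g x - m := hg.sub_const m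
  have hgB : ∀ x, |g x - m| ≤ B + |m| := fun x => (abs_sub _ _).trans (by gcongr; exact hB x)
  -- The centred sum is a martingale: the action is drawn before the reward, so each increment has
  -- conditional mean zero.
  have key : ∫ h, statSum (fun x => g x - m) h p i ∂A.law I t = 0 := by
    induction t with
    | zero => simp [statSum_zero]
    | succ t ih =>
      rw [integral_law_succ A I (measurable_statSum hgm p i) fun h => abs_statSum_le hgB h p i,
        ← ih]
      congr 1
      ext h
      have hmi : Measurable fun x : Action M K × (Fin M → ℝ) =>
          if x.1 p = i then g (x.2 p) - m else 0 :=
        measurable_roundStat hgm p i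
      have hbd : ∀ x : Action M K × (Fin M → ℝ),
          |if x.1 p = i then g (x.2 p) - m else 0| ≤ B + |m| := fun x => by
        split_ifs
        · exact hgB _
        · simpa using by positivity
      simp_rw [statSum_extend]
      rw [integral_add (integrable_const _)
          (.of_bound hmi.aestronglyMeasurable _ (.of_forall hbd)),
        integral_step A I h hmi hbd]
      have : ∀ a : Action M K, ∫ r, (if a p = i then g (r p) - m else 0) ∂I.rewardKernel a = 0 := by
        intro a
        split_ifs with ha
        · rw [I.rewardKernel_apply,
            integral_comp_eval (μ := fun q => I.dist q (a q)) (i := p) (f := fun x => g x - m)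
              hgm.aestronglyMeasurable, ha, integral_sub (.of_bound hg.aestronglyMeasurable B (.of_forall hB))
              (integrable_const _), ← hm]
          simp
        · simp
      simp [this]
  have hsplit : ∀ h : Hist M K t,
      statSum (fun x => g x - m) h p i = statSum g h p i - m * pullCount h p i := by
    intro h
    simp only [statSum, pullCount, Nat.cast_sum, Finset.mul_sum, ← Finset.sum_sub_distrib]
    refine Finset.sum_congr rfl fun s _ => ?_
    split_ifs <;> simp
  simp_rw [hsplit] at key
  rw [integral_sub (integrable_statSum A I hg hB p i) ((integrable_pullCount A I p i).const_mul m),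
    integral_const_mul] at key
  linarith

/-- An exponential supermartingale stays below its initial value. -/
lemma lintegral_exp_statSum_le {g : ℝ → ℝ} (hg : Measurable g) (p : Fin M) (i : Fin K)
    (h1 : ∫⁻ x, ENNReal.ofReal (Real.exp (g x)) ∂I.dist p i ≤ 1) (t : ℕ) :
    ∫⁻ h, ENNReal.ofReal (Real.exp (statSum g h p i)) ∂A.law I t ≤ 1 := by
  induction t with
  | zero => simp [statSum_zero]
  | succ t ih =>
    rw [lintegral_law_succ A I (measurable_statSum hg p i).exp.ennreal_ofReal]
    refine (lintegral_mono fun h => ?_).trans ih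
    have hmi : Measurable fun x : Action M K × (Fin M → ℝ) =>
        if x.1 p = i then g (x.2 p) else 0 :=
      measurable_roundStat hg p i
    simp_rw [statSum_extend, Real.exp_add, ENNReal.ofReal_mul (Real.exp_nonneg _)]
    rw [lintegral_const_mul _ hmi.exp.ennreal_ofReal]
    refine mul_le_of_le_one_right' ?_
    rw [lintegral_step A I h hmi.exp.ennreal_ofReal]
    have : ∀ a : Action M K, ∫⁻ r, ENNReal.ofReal (Real.exp (if a p = i then g (r p) else 0))
        ∂I.rewardKernel a ≤ 1 := by
      intro a
      split_ifs with ha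
      · rw [I.rewardKernel_apply, (measurePreserving_eval (fun q => I.dist q (a q)) p).lintegral_comp
          hg.exp.ennreal_ofReal (f := fun x => ENNReal.ofReal (Real.exp (g x))), ha]
        exact h1
      · simp
    calc _ ≤ ∫⁻ _, 1 ∂A.policy t h := lintegral_mono this
      _ = 1 := by simp

/-- It suffices to test on boxes. There the density involves one coordinate only, so its integral is
the integral over that factor times the masses of the other sides. -/
lemma pi_withDensity_eval {ι : Type*} [Fintype ι] (μ ν : ι → Measure ℝ)
    [∀ q, IsProbabilityMeasure (μ q)] [∀ q, IsProbabilityMeasure (ν q)] (p : ι)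
    {w : ℝ → ENNReal} (hw : Measurable w) (hp : ν p = (μ p).withDensity w)
    (hq : ∀ q, q ≠ p → ν q = μ q) :
    Measure.pi ν = (Measure.pi μ).withDensity fun r => w (r p) := by
  classical
  refine Measure.pi_eq fun s hs => ?_
  rw [withDensity_apply _ (MeasurableSet.univ_pi hs), Measure.restrict_pi_pi,
    ← lintegral_map (g := fun r : ι → ℝ => r p) (f := w) hw (measurable_pi_apply p)]
  have := Measure.pi_map_eval (μ := fun i => (μ i).restrict (s i)) p
  rw [show (fun r : ι → ℝ => r p) = Function.eval p from rfl, this, lintegral_smul_measure,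
    ← Finset.prod_erase_mul _ _ (Finset.mem_univ p), hp, withDensity_apply _ (hs p), smul_eq_mul]
  congr 1
  refine Finset.prod_congr rfl fun q hqe => ?_
  rw [hq q (Finset.ne_of_mem_erase hqe), Measure.restrict_apply_univ]

/-- The likelihood ratio of one round. The policy is the same under both instances, so only the
reward kernel contributes, and only when `p` pulls `i`. -/
lemma rewardKernel_withDensity {I J : Instance M K} {g : ℝ → ℝ} (hg : Measurable g) (p : Fin M)
    (i : Fin K)
    (hp : J.dist p i = (I.dist p i).withDensity fun x => ENNReal.ofReal (Real.exp (g x)))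
    (hq : ∀ q j, ¬ (q = p ∧ j = i) → J.dist q j = I.dist q j) (a : Action M K) :
    J.rewardKernel a = (I.rewardKernel a).withDensity
      fun r => ENNReal.ofReal (Real.exp (if a p = i then g (r p) else 0)) := by
  rw [I.rewardKernel_apply, J.rewardKernel_apply]
  by_cases ha : a p = i
  · have := pi_withDensity_eval (fun q => I.dist q (a q)) (fun q => J.dist q (a q)) p
      (w := fun x => ENNReal.ofReal (Real.exp (g x))) hg.exp.ennreal_ofReal
      (by simp only [ha, hp]) (fun q hqp => hq _ _ fun h => hqp h.1)
    simp only [this, ha, if_true]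
  · have : (fun q => J.dist q (a q)) = fun q => I.dist q (a q) := by
      ext1 q
      exact hq _ _ fun h => ha (by rw [← h.1]; exact h.2)
    have h1 : (fun _ : Fin M → ℝ => (1 : ENNReal)) = 1 := rfl
    simp only [this, ha, if_false, Real.exp_zero, ENNReal.ofReal_one, h1, withDensity_one]

/-- Change of measure between two instances that differ in a single reward distribution. -/
lemma lintegral_law_change {I J : Instance M K} {g : ℝ → ℝ} (hg : Measurable g) (p : Fin M)
    (i : Fin K)
    (hp : J.dist p i = (I.dist p i).withDensity fun x => ENNReal.ofReal (Real.exp (g x)))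
    (hq : ∀ q j, ¬ (q = p ∧ j = i) → J.dist q j = I.dist q j) (t : ℕ)
    {f : Hist M K t → ENNReal} (hf : Measurable f) :
    ∫⁻ h, f h ∂A.law J t
      = ∫⁻ h, ENNReal.ofReal (Real.exp (statSum g h p i)) * f h ∂A.law I t := by
  have hmi : Measurable fun x : Action M K × (Fin M → ℝ) =>
      if x.1 p = i then g (x.2 p) else 0 :=
    measurable_roundStat hg p i
  have hrew := rewardKernel_withDensity hg p i hp hq
  induction t with
  | zero => simp [statSum_zero, Algorithm.law]
  | succ t ih =>
    rw [lintegral_law_succ A J hf, lintegral_law_succ A I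
        (f := fun h => ENNReal.ofReal (Real.exp (statSum g h p i)) * f h)
        ((measurable_statSum hg p i).exp.ennreal_ofReal.mul hf),
      -- The first `t` rounds are changed by induction, applied to the conditional expectation of
      -- `f` under `J`; the last round is then changed inside the integral.
      ih (f := fun h => ∫⁻ x, f (extend h x) ∂A.step J t h)
        (Measurable.lintegral_kernel_prod_right' (f := fun x => f (extend x.1 x.2))
          (hf.comp measurable_extend))]
    refine lintegral_congr fun h => ?_
    have hfe : Measurable fun x => f (extend h x) :=
      hf.comp (measurable_extend.comp measurable_prodMk_left)
    simp_rw [statSum_extend, Real.exp_add, ENNReal.ofReal_mul (Real.exp_nonneg _), mul_assoc]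
    have hm : Measurable fun x : Action M K × (Fin M → ℝ) => ENNReal.ofReal (Real.exp
        (if x.1 p = i then g (x.2 p) else 0)) * f (extend h x) := hmi.exp.ennreal_ofReal.mul hfe
    rw [lintegral_const_mul _ hm]
    congr 1
    rw [lintegral_step A J h hfe, lintegral_step A I h hm]
    refine lintegral_congr fun a => ?_
    rw [hrew a, lintegral_withDensity_eq_lintegral_mul _
      (f := fun r => ENNReal.ofReal (Real.exp (if a p = i then g (r p) else 0)))
      (hmi.exp.ennreal_ofReal.comp measurable_prodMk_left)
      (g := fun r => f (extend h (a, r))) (hfe.comp measurable_prodMk_left)]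
    rfl

end Law

/-! ### The lower bound. -/

section LowerBound

variable {M K : ℕ}

lemma integral_law_change (A : Algorithm M K) {I J : Instance M K} {g : ℝ → ℝ} (hg : Measurable g)
    (p : Fin M) (i : Fin K)
    (hp : J.dist p i = (I.dist p i).withDensity fun x => ENNReal.ofReal (Real.exp (g x)))
    (hq : ∀ q j, ¬ (q = p ∧ j = i) → J.dist q j = I.dist q j) (t : ℕ)
    {f : Hist M K t → ℝ} (hf : Measurable f) (hf0 : ∀ h, 0 ≤ f h) :
    ∫ h, f h ∂A.law J t = ∫ h, Real.exp (statSum g h p i) * f h ∂A.law I t := by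
  have hexp : Measurable fun h : Hist M K t => Real.exp (statSum g h p i) :=
    (measurable_statSum hg p i).exp
  rw [integral_eq_lintegral_of_nonneg_ae (.of_forall hf0) hf.aestronglyMeasurable,
    integral_eq_lintegral_of_nonneg_ae
      (.of_forall fun h => mul_nonneg (Real.exp_nonneg _) (hf0 h))
      (hexp.mul hf).aestronglyMeasurable,
    lintegral_law_change A hg p i hp hq t hf.ennreal_ofReal]
  simp_rw [ENNReal.ofReal_mul (Real.exp_nonneg _)]

/-- A replacement for the Bretagnolle–Huber inequality. With `ℓ` a log-likelihood ratio, the left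
side involves only `ℓ` and `exp ℓ`, linearly, and both have known expectations. Both bounds come
from `x + 1 ≤ exp x`. -/
lemma exp_neg_mul_le_min (m ℓ : ℝ) :
    Real.exp (-m) * (1 + m + ℓ - Real.exp ℓ) ≤ min 1 (Real.exp ℓ) := by
  have h1 := Real.add_one_le_exp ℓ
  have h2 := Real.add_one_le_exp (m + ℓ)
  have h3 := Real.add_one_le_exp m
  have h4 : Real.exp (-m) * Real.exp m = 1 := by rw [← Real.exp_add]; simp
  have h5 : Real.exp (-m) * Real.exp (m + ℓ) = Real.exp ℓ := by rw [← Real.exp_add]; simp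
  refine le_min ?_ ?_
  · rw [← h4]
    gcongr
    linarith
  · rw [← h5]
    gcongr
    linarith [Real.exp_pos ℓ]

/-- If two instances differ only in the reward distribution of arm `i` of player `p`, then the
player cannot both pull this arm rarely in `I` and pull the other arms rarely in `J`. -/
lemma mul_exp_le_pullCount_add (A : Algorithm M K) {I J : Instance M K} {g : ℝ → ℝ}
    (hg : Measurable g) {B : ℝ} (hB : ∀ x, |g x| ≤ B) (p : Fin M) (i : Fin K)
    (hp : J.dist p i = (I.dist p i).withDensity fun x => ENNReal.ofReal (Real.exp (g x)))
    (hq : ∀ q j, ¬ (q = p ∧ j = i) → J.dist q j = I.dist q j) (T : ℕ) :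
    T * Real.exp ((∫ x, g x ∂I.dist p i) * ∫ h, (pullCount h p i : ℝ) ∂A.law I T - 1)
      ≤ ∫ h, (pullCount h p i : ℝ) ∂A.law I T
        + (T - ∫ h, (pullCount h p i : ℝ) ∂A.law J T) := by
  have hn : Measurable fun h : Hist M K T => (T : ℝ) - pullCount h p i :=
    measurable_const.sub (measurable_from_top.comp (measurable_pullCount p i))
  have hle : ∀ h : Hist M K T, (pullCount h p i : ℝ) ≤ T := fun h => by
    exact_mod_cast pullCount_le h p i
  have hL : Measurable fun h : Hist M K T => Real.exp (statSum g h p i) :=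
    (measurable_statSum hg p i).exp
  have hLB : ∀ h : Hist M K T, |Real.exp (statSum g h p i)| ≤ Real.exp (T * B) := fun h => by
    rw [Real.abs_exp]
    exact Real.exp_le_exp.2 ((le_abs_self _).trans (abs_statSum_le hB h p i))
  have iL : Integrable (fun h : Hist M K T => Real.exp (statSum g h p i)) (A.law I T) :=
    .of_bound hL.aestronglyMeasurable _ (.of_forall hLB)
  have iN := integrable_pullCount (t := T) A I p i
  have iS := integrable_statSum (t := T) A I hg hB p i
  have iLn : Integrable (fun h : Hist M K T =>
      Real.exp (statSum g h p i) * (T - pullCount h p i)) (A.law I T) := by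
    refine .of_bound (hL.mul hn).aestronglyMeasurable (Real.exp (T * B) * T) (.of_forall fun h => ?_)
    rw [norm_mul]
    gcongr
    · exact hLB h
    · rw [Real.norm_of_nonneg (sub_nonneg.2 (hle h))]
      linarith [Nat.cast_nonneg (α := ℝ) (pullCount h p i)]
  have e1 : (T - ∫ h, (pullCount h p i : ℝ) ∂A.law J T)
      = ∫ h, Real.exp (statSum g h p i) * (T - pullCount h p i) ∂A.law I T := by
    rw [← integral_law_change A hg p i hp hq T hn fun h => sub_nonneg.2 (hle h),
      integral_sub (integrable_const _) (integrable_pullCount A J p i)]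
    simp
  have e2 : ∫ h, Real.exp (statSum g h p i) ∂A.law I T = 1 := by
    have := integral_law_change A hg p i hp hq T (f := fun _ => 1) measurable_const (by simp)
    simpa using this.symm
  have e3 := integral_statSum A I hg hB T p i
  set E := (∫ x, g x ∂I.dist p i) * ∫ h, (pullCount h p i : ℝ) ∂A.law I T
  -- For general m the expectation is T exp(-m) (m + E), because the likelihood ratio has mean 1 and
  -- its logarithm has mean `E`. The choice m = 1 - `E` maximizes it.
  have e4 : ∫ h, T * (Real.exp (-(1 - E)) *
      (1 + (1 - E) + statSum g h p i - Real.exp (statSum g h p i))) ∂A.law I T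
      = T * Real.exp (E - 1) := by
    rw [integral_const_mul, integral_const_mul, integral_sub (by fun_prop) iL,
      integral_add (by fun_prop) iS, e2, e3]
    simp only [integral_const, probReal_univ, one_smul]
    rw [show 1 + (1 - E) + E - 1 = 1 by ring, mul_one, neg_sub]
  rw [e1, ← integral_add iN iLn, ← e4]
  refine integral_mono (by fun_prop) (iN.add iLn) fun h => ?_
  -- Pointwise, with n pulls and likelihood ratio L, n + L (T - n) ≥ T min(1, L).
  have h1 := exp_neg_mul_le_min (1 - E) (statSum g h p i)
  have h2 := h1.trans (min_le_left _ _)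
  have h3 := h1.trans (min_le_right _ _)
  have h4 : (0 : ℝ) ≤ pullCount h p i := Nat.cast_nonneg _
  nlinarith [mul_le_mul_of_nonneg_left h2 h4, mul_le_mul_of_nonneg_right h3
    (sub_nonneg.2 (hle h))]

lemma bernoulliInstance_mean (μ : Fin M → Fin K → unitInterval) (p : Fin M) (i : Fin K) :
    (bernoulliInstance μ).mean p i = μ p i := by
  simp [Instance.mean, bernoulliInstance, integral_bernoulliMeasure]

lemma Instance.gap_nonneg (I : Instance M K) (p : Fin M) (i : Fin K) : 0 ≤ I.gap p i :=
  sub_nonneg.2 (le_ciSup (f := fun j => I.mean p j) (Set.finite_range _).bddAbove i)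

lemma Instance.gap_fin_two (I : Instance M 2) (p : Fin M) (i : Fin 2) :
    I.gap p i = max (I.mean p 0) (I.mean p 1) - I.mean p i := by
  have h : (⨆ j, I.mean p j) = max (I.mean p 0) (I.mean p 1) := by
    refine le_antisymm (ciSup_le fun j => ?_) (max_le ?_ ?_)
    · fin_cases j <;> simp
    all_goals exact le_ciSup (f := fun j => I.mean p j) (Set.finite_range _).bddAbove _
  rw [Instance.gap, h]

lemma pullCount_fin_two {t : ℕ} (h : Hist M 2 t) (p : Fin M) :
    pullCount h p 0 + pullCount h p 1 = t := by
  rw [pullCount, pullCount, ← Finset.sum_add_distrib]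
  calc _ = ∑ _s : Fin t, 1 := Finset.sum_congr rfl fun s _ => by
        rcases Fin.exists_fin_two.1 ⟨(h s).1 p, rfl⟩ with h' | h' <;> simp [h']
    _ = t := by simp

lemma integral_pullCount_nonneg (A : Algorithm M K) (I : Instance M K) (t : ℕ) (p : Fin M)
    (i : Fin K) : 0 ≤ ∫ h, (pullCount h p i : ℝ) ∂A.law I t :=
  integral_nonneg fun _ => Nat.cast_nonneg _

lemma gap_mul_le_regret (A : Algorithm M K) (I : Instance M K) (T : ℕ) (p : Fin M) (i : Fin K) :
    I.gap p i * ∫ h, (pullCount h p i : ℝ) ∂A.law I T ≤ A.regret I T := by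
  have h0 : ∀ q j, 0 ≤ I.gap q j * ∫ h, (pullCount h q j : ℝ) ∂A.law I T := fun q j =>
    mul_nonneg (I.gap_nonneg q j) (integral_pullCount_nonneg A I T q j)
  calc _ ≤ ∑ j, I.gap p j * ∫ h, (pullCount h p j : ℝ) ∂A.law I T :=
        Finset.single_le_sum (fun j _ => h0 p j) (Finset.mem_univ i)
    _ ≤ A.regret I T := Finset.single_le_sum
        (f := fun q => ∑ j, I.gap q j * ∫ h, (pullCount h q j : ℝ) ∂A.law I T)
        (fun q _ => Finset.sum_nonneg fun j _ => h0 q j) (Finset.mem_univ p)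

lemma regret_eq_of_gap (A : Algorithm M 2) (I : Instance M 2) (δ : ℝ) (h0 : ∀ p, I.gap p 0 = 0)
    (h1 : ∀ p, I.gap p 1 = δ) (T : ℕ) :
    A.regret I T = ∑ p, δ * ∫ h, (pullCount h p 1 : ℝ) ∂A.law I T := by
  simp [Algorithm.regret, Fin.sum_univ_two, h0, h1]

/-- The log-likelihood ratio of the Bernoulli distributions with means `1 / 2 + 2 * δ` and
`1 / 2`. -/
noncomputable def logRatio (δ x : ℝ) : ℝ :=
  if x = 1 then Real.log (1 + 4 * δ) else Real.log (1 - 4 * δ)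

lemma measurable_logRatio (δ : ℝ) : Measurable (logRatio δ) :=
  Measurable.ite (measurableSet_singleton 1) measurable_const measurable_const

lemma abs_logRatio_le (δ x : ℝ) :
    |logRatio δ x| ≤ max |Real.log (1 + 4 * δ)| |Real.log (1 - 4 * δ)| := by
  unfold logRatio
  split_ifs
  · exact le_max_left _ _
  · exact le_max_right _ _

/-- The ratios of the masses at 1 and at 0 are 1 + 4δ and 1 - 4δ; `δ < 1 / 4` keeps the latter
positive, so that `exp` undoes `log`. -/
lemma bernoulliMeasure_withDensity_logRatio {δ : ℝ} (h0 : 0 < δ) (h1 : δ < 1 / 4)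
    {a b : unitInterval} (ha : (a : ℝ) = 1 / 2) (hb : (b : ℝ) = 1 / 2 + 2 * δ) :
    bernoulliMeasure (1 : ℝ) 0 b = (bernoulliMeasure (1 : ℝ) 0 a).withDensity
      fun x => ENNReal.ofReal (Real.exp (logRatio δ x)) := by
  have hm : Measurable fun x => ENNReal.ofReal (Real.exp (logRatio δ x)) :=
    (measurable_logRatio δ).exp.ennreal_ofReal
  have e1 : (unitInterval.toNNReal b : ENNReal) = unitInterval.toNNReal a *
      ENNReal.ofReal (1 + 4 * δ) := by
    have : ∀ c : unitInterval, (unitInterval.toNNReal c : ENNReal) = ENNReal.ofReal c := fun c => by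
      rw [ENNReal.ofReal, Real.toNNReal_of_nonneg c.2.1]; rfl
    rw [this, this, ← ENNReal.ofReal_mul a.2.1, ha, hb]
    congr 1
    ring
  have e2 : (unitInterval.toNNReal (unitInterval.symm b) : ENNReal) =
      unitInterval.toNNReal (unitInterval.symm a) * ENNReal.ofReal (1 - 4 * δ) := by
    have : ∀ c : unitInterval, (unitInterval.toNNReal c : ENNReal) = ENNReal.ofReal c := fun c => by
      rw [ENNReal.ofReal, Real.toNNReal_of_nonneg c.2.1]; rfl
    rw [this, this, ← ENNReal.ofReal_mul (unitInterval.symm a).2.1, unitInterval.coe_symm_eq,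
      unitInterval.coe_symm_eq, ha, hb]
    congr 1
    ring
  ext s hs
  rw [withDensity_apply _ hs, ← lintegral_indicator hs, bernoulliMeasure_def, bernoulliMeasure_def,
    lintegral_add_measure]
  simp only [Measure.add_apply, Measure.smul_apply, ENNReal.smul_def, smul_eq_mul,
    lintegral_smul_measure, lintegral_dirac, Measure.dirac_apply, e1, e2]
  simp only [Set.indicator, logRatio, Pi.one_apply]
  have hp1 : 0 < 1 + 4 * δ := by linarith
  have hp2 : 0 < 1 - 4 * δ := by linarith
  split_ifs <;> simp_all [Real.exp_log]

/-- The integral is minus a Kullback–Leibler divergence and equals ½ log(1 - 16δ²). The bound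
follows from log x ≥ 1 - 1/x and 1/(1 - y) ≤ 1 + 2y for y = 16δ² ≤ 1/2. -/
lemma neg_le_integral_logRatio {δ : ℝ} (h0 : 0 < δ) (h1 : δ ≤ 1 / 32) {a : unitInterval}
    (ha : (a : ℝ) = 1 / 2) :
    -(16 * δ ^ 2) ≤ ∫ x, logRatio δ x ∂bernoulliMeasure (1 : ℝ) 0 a := by
  rw [integral_bernoulliMeasure, ha]
  simp only [logRatio, if_true, zero_ne_one, if_false, smul_eq_mul]
  have hsq : δ ^ 2 ≤ 1 / 32 * (1 / 32) := by nlinarith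
  have hx : 0 < (1 + 4 * δ) * (1 - 4 * δ) := by nlinarith
  have h2 : Real.log (1 + 4 * δ) + Real.log (1 - 4 * δ) = Real.log ((1 + 4 * δ) * (1 - 4 * δ)) :=
    (Real.log_mul (by linarith) (by linarith)).symm
  have h3 := Real.one_sub_inv_le_log_of_pos hx
  have h4 : ((1 + 4 * δ) * (1 - 4 * δ))⁻¹ ≤ 1 + 32 * δ ^ 2 := by
    rw [inv_le_iff_one_le_mul₀ hx]
    nlinarith [sq_nonneg δ, sq_nonneg (δ ^ 2)]
  linarith

lemma integral_pullCount_ge_of_sublinear {C α δ ε : ℝ} (hδ : 0 < δ) (hε : ε < 1 / 8)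
    (hδε : δ ≤ ε / 4) (A : ℕ → Algorithm M 2) (hA : SublinearRegretWith C α ε A)
    (μ : Fin M → Fin 2 → unitInterval) (h0 : ∀ p, (μ p 0 : ℝ) = 1 / 2 + δ)
    (h1 : ∀ p, (μ p 1 : ℝ) = 1 / 2) {T : ℕ} (hT : max M 2 < T) (p : Fin M) :
    α * Real.log T - Real.log (2 * C / δ) - 1 ≤
      16 * δ ^ 2 * ∫ h, (pullCount h p 1 : ℝ) ∂(A T).law (bernoulliInstance μ) T := by
  classical
  obtain ⟨hC, -, hreg⟩ := hA
  have hT0 : (0 : ℝ) < T := by exact_mod_cast (Nat.zero_le _).trans_lt hT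
  -- The shift 2δ gives the mistaken choice in the altered instance the same gap δ as in the
  -- original one.
  let b : unitInterval := ⟨1 / 2 + 2 * δ, by constructor <;> linarith⟩
  let μ' : Fin M → Fin 2 → unitInterval := fun q j => if q = p ∧ j = 1 then b else μ q j
  set I := bernoulliInstance μ with hI
  set J := bernoulliInstance μ' with hJ
  have hb : (b : ℝ) = 1 / 2 + 2 * δ := rfl
  have hμ'0 : ∀ q, (μ' q 0 : ℝ) = 1 / 2 + δ := fun q => by simp [μ', h0]
  have hμ'p : (μ' p 1 : ℝ) = 1 / 2 + 2 * δ := by simp [μ', hb]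
  have hμ'1 : ∀ q, (μ' q 1 : ℝ) = 1 / 2 + 2 * δ ∨ (μ' q 1 : ℝ) = 1 / 2 := fun q => by
    by_cases hqp : q = p
    · exact .inl (hqp ▸ hμ'p)
    · exact .inr (by simp [μ', hqp, h1])
  have hId : I.IsDissimilarity ε := by
    intro q r j
    simp only [hI, bernoulliInstance_mean]
    rcases Fin.exists_fin_two.1 ⟨j, rfl⟩ with rfl | rfl
    · rw [h0, h0, sub_self, abs_zero]; linarith
    · rw [h1, h1, sub_self, abs_zero]; linarith
  have hJd : J.IsDissimilarity ε := by
    intro q r j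
    simp only [hJ, bernoulliInstance_mean]
    rcases Fin.exists_fin_two.1 ⟨j, rfl⟩ with rfl | rfl
    · rw [hμ'0, hμ'0, sub_self, abs_zero]; linarith
    · rw [abs_le]
      rcases hμ'1 q with h | h <;> rcases hμ'1 r with h' | h' <;> rw [h, h'] <;>
        constructor <;> linarith
  have rI := (gap_mul_le_regret (A T) I T p 1).trans (hreg T hT I hId)
  have rJ := (gap_mul_le_regret (A T) J T p 0).trans (hreg T hT J hJd)
  rw [I.gap_fin_two, bernoulliInstance_mean, bernoulliInstance_mean, h0, h1,
    max_eq_left (by linarith), add_sub_cancel_left] at rI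
  rw [J.gap_fin_two, bernoulliInstance_mean, bernoulliInstance_mean, hμ'0, hμ'p,
    max_eq_right (by linarith), show 1 / 2 + 2 * δ - (1 / 2 + δ) = δ by ring] at rJ
  have hJn : ∫ h, (pullCount h p 0 : ℝ) ∂(A T).law J T
      = T - ∫ h, (pullCount h p 1 : ℝ) ∂(A T).law J T := by
    have : ∀ h : Hist M 2 T, (pullCount h p 0 : ℝ) = T - pullCount h p 1 := fun h => by
      rw [eq_sub_iff_add_eq]
      exact_mod_cast pullCount_fin_two h p
    simp_rw [this]
    rw [integral_sub (integrable_const _) (integrable_pullCount _ J p 1)]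
    simp
  have hd1 : I.dist p 1 = bernoulliMeasure (1 : ℝ) 0 (μ p 1) := rfl
  have key := mul_exp_le_pullCount_add (A T) (I := I) (J := J) (measurable_logRatio δ)
    (abs_logRatio_le δ) p 1
    (by
      have : J.dist p 1 = bernoulliMeasure (1 : ℝ) 0 b := by simp [hJ, bernoulliInstance, μ']
      rw [this, hd1]
      exact bernoulliMeasure_withDensity_logRatio hδ (by linarith) (h1 p) hb)
    (fun q j hqj => by simp [hI, hJ, bernoulliInstance, μ', hqj]) T
  have hkl := neg_le_integral_logRatio hδ (by linarith) (h1 p)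
  rw [← hd1] at hkl
  have hn0 := integral_pullCount_nonneg (A T) I T p 1
  set n := ∫ h, (pullCount h p 1 : ℝ) ∂(A T).law I T
  rw [hJn] at rJ
  -- The factor 2 adds the regret bounds of the two instances.
  have hmain : δ * (T * Real.exp (-(16 * δ ^ 2) * n - 1)) ≤ 2 * C * (T : ℝ) ^ (1 - α) := by
    calc _ ≤ δ * (T * Real.exp ((∫ x, logRatio δ x ∂I.dist p 1) * n - 1)) := by gcongr
      _ ≤ δ * (n + (T - ∫ h, (pullCount h p 1 : ℝ) ∂(A T).law J T)) := by gcongr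
      _ ≤ _ := by linarith
  have hlog := Real.log_le_log (by positivity) hmain
  rw [Real.log_mul hδ.ne' (by positivity), Real.log_mul hT0.ne' (by positivity), Real.log_exp,
    Real.log_mul (by positivity) (by positivity), Real.log_rpow hT0] at hlog
  rw [Real.log_div (by positivity) hδ.ne']
  linarith

lemma gap_zero_of_means {δ : ℝ} (hδ : 0 ≤ δ) (μ : Fin M → Fin 2 → unitInterval)
    (h0 : ∀ p, (μ p 0 : ℝ) = 1 / 2 + δ) (h1 : ∀ p, (μ p 1 : ℝ) = 1 / 2) (p : Fin M) :
    (bernoulliInstance μ).gap p 0 = 0 := by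
  rw [Instance.gap_fin_two, bernoulliInstance_mean, bernoulliInstance_mean, h0, h1,
    max_eq_left (by linarith), sub_self]

lemma gap_one_of_means {δ : ℝ} (hδ : 0 ≤ δ) (μ : Fin M → Fin 2 → unitInterval)
    (h0 : ∀ p, (μ p 0 : ℝ) = 1 / 2 + δ) (h1 : ∀ p, (μ p 1 : ℝ) = 1 / 2) (p : Fin M) :
    (bernoulliInstance μ).gap p 1 = δ := by
  rw [Instance.gap_fin_two, bernoulliInstance_mean, bernoulliInstance_mean, h0, h1,
    max_eq_left (by linarith), add_sub_cancel_left]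

/-- The regret lower bound for algorithms with sublinear regret. -/
theorem regret_lower_bound {C α δ : ℝ} (hα : 0 < α) (hδ : 0 < δ) : ∃ T₀ : ℕ,
    ∀ ε : ℝ, ε < 1 / 8 → δ ≤ ε / 4 →
    ∀ (M : ℕ) (A : ℕ → Algorithm M 2), SublinearRegretWith C α ε A →
    ∀ μ : Fin M → Fin 2 → unitInterval,
      (∀ p, (μ p 0 : ℝ) = 1 / 2 + δ) → (∀ p, (μ p 1 : ℝ) = 1 / 2) →
    ∀ T : ℕ, max M 2 < T → T₀ ≤ T →
      1 / 32 * α * (M * Real.log T / δ) ≤ (A T).regret (bernoulliInstance μ) T := by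
  -- From this horizon on, the additive loss 1 + log(2C/δ) is at most half of α log T. The remaining
  -- half, divided by 16δ² and multiplied by the gap δ, yields the constant 1/32.
  refine ⟨⌈Real.exp (2 / α * (1 + Real.log (2 * C / δ)))⌉₊, ?_⟩
  intro ε hε hδε M A hA μ h0 h1 T hT hT₀
  have hT0 : (0 : ℝ) < T := by exact_mod_cast (Nat.zero_le _).trans_lt hT
  have hlog : 2 / α * (1 + Real.log (2 * C / δ)) ≤ Real.log T :=
    (Real.le_log_iff_exp_le hT0).2 ((Nat.le_ceil _).trans (by exact_mod_cast hT₀))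
  have hlog' : 1 + Real.log (2 * C / δ) ≤ α / 2 * Real.log T := by
    calc _ = α / 2 * (2 / α * (1 + Real.log (2 * C / δ))) := by field_simp
      _ ≤ _ := by gcongr
  rw [regret_eq_of_gap (A T) _ δ (gap_zero_of_means hδ.le μ h0 h1)
    (gap_one_of_means hδ.le μ h0 h1)]
  calc 1 / 32 * α * (M * Real.log T / δ) = ∑ _p : Fin M, 1 / 32 * α * (Real.log T / δ) := by
        simp; ring
    _ ≤ _ := Finset.sum_le_sum fun p _ => ?_
  have := integral_pullCount_ge_of_sublinear hδ hε hδε A hA μ h0 h1 hT p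
  set n := ∫ h, (pullCount h p 1 : ℝ) ∂(A T).law (bernoulliInstance μ) T
  rw [← mul_div_assoc, div_le_iff₀ hδ]
  nlinarith

end LowerBound

/-! ### The upper bound for Ind-UCB. -/

section UpperBound

variable {M K : ℕ}

lemma statSum_affine (θ m c : ℝ) {t : ℕ} (h : Hist M K t) (p : Fin M) (i : Fin K) :
    statSum (fun x => θ * (x - m) - c) h p i
      = θ * (rewardSum h p i - m * pullCount h p i) - pullCount h p i * c := by
  simp only [statSum, rewardSum, pullCount, Nat.cast_sum, Finset.mul_sum, Finset.sum_mul,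
    ← Finset.sum_sub_distrib]
  refine Finset.sum_congr rfl fun s _ => ?_
  split_ifs <;> simp

/-- Hoeffding's lemma for the reward distributions. -/
lemma Instance.lintegral_exp_le_one (I : Instance M K) (p : Fin M) (i : Fin K) (θ : ℝ) :
    ∫⁻ x, ENNReal.ofReal (Real.exp (θ * (x - I.mean p i) - θ ^ 2 / 8)) ∂I.dist p i ≤ 1 := by
  have hs := hasSubgaussianMGF_of_mem_Icc (μ := I.dist p i) (X := fun x => x) (a := 0) (b := 1)
    aemeasurable_id (I.mem_Icc p i)
  have hle := hs.mgf_le θ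
  have hint := hs.integrable_exp_mul θ
  simp_rw [sub_eq_add_neg _ (θ ^ 2 / 8), Real.exp_add, ENNReal.ofReal_mul (Real.exp_nonneg _)]
  rw [lintegral_mul_const _ (by fun_prop)]
  change (∫⁻ x, ENNReal.ofReal (Real.exp (θ * (x - ∫ x, x ∂I.dist p i))) ∂I.dist p i) * _ ≤ 1
  rw [← ofReal_integral_eq_lintegral_ofReal hint (.of_forall fun x => Real.exp_nonneg _),
    ← ENNReal.ofReal_mul (integral_nonneg fun x => Real.exp_nonneg _), ← ENNReal.ofReal_one]
  refine ENNReal.ofReal_le_ofReal ?_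
  rw [mgf] at hle
  calc _ ≤ Real.exp (((‖(1 : ℝ) - 0‖₊ / 2) ^ 2 : NNReal) * θ ^ 2 / 2) * Real.exp (-(θ ^ 2 / 8)) := by
        gcongr
    _ = 1 := by
        rw [← Real.exp_add, Real.exp_eq_one_iff]
        push_cast
        simp
        ring

/-- Hoeffding's inequality on the event of exactly `s` pulls, for adaptively chosen pulls. -/
lemma law_deviation_le (A : Algorithm M K) (I : Instance M K) (t : ℕ) (p : Fin M) (i : Fin K)
    (s : ℕ) (θ c : ℝ) :
    A.law I t {h | pullCount h p i = s ∧
      c ≤ θ * (rewardSum h p i - I.mean p i * s) - s * (θ ^ 2 / 8)}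
      ≤ ENNReal.ofReal (Real.exp (-c)) := by
  have hg : Measurable fun x : ℝ => θ * (x - I.mean p i) - θ ^ 2 / 8 := by fun_prop
  have hle := lintegral_exp_statSum_le A I hg p i (I.lintegral_exp_le_one p i θ) t
  have hm := mul_meas_ge_le_lintegral (μ := A.law I t)
    (measurable_statSum hg p i).exp.ennreal_ofReal (ENNReal.ofReal (Real.exp c))
  rw [Real.exp_neg, ENNReal.ofReal_inv_of_pos (Real.exp_pos c), ENNReal.le_inv_iff_mul_le, mul_comm]
  refine le_trans ?_ (hm.trans hle)
  gcongr with h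
  intro hs
  refine ENNReal.ofReal_le_ofReal (Real.exp_le_exp.2 ?_)
  rw [statSum_affine, hs.1]
  exact hs.2

/-- The event that the mean reward of arm `i` for player `p` deviates, in the direction `σ`, from
its empirical mean by at least the confidence radius of UCB-1. -/
def deviation (I : Instance M K) (t : ℕ) (p : Fin M) (i : Fin K) (σ : ℝ) : Set (Hist M K t) :=
  {h | 0 < pullCount h p i ∧ pullCount h p i * √(2 * Real.log t / pullCount h p i)
    ≤ σ * (rewardSum h p i - I.mean p i * pullCount h p i)}

/-- The number of pulls is random, so a union bound runs over its possible values s ≤ t, whence the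
factor `t`. -/
lemma law_deviation_le_sum (A : Algorithm M K) (I : Instance M K) (t : ℕ) (p : Fin M) (i : Fin K)
    {σ : ℝ} (hσ : σ ^ 2 = 1) :
    A.law I t (deviation I t p i σ) ≤ ENNReal.ofReal (t * Real.exp (-(4 * Real.log t))) := by
  have hL : 0 ≤ Real.log t := Real.log_natCast_nonneg t
  -- With confidence radius r, the exponent θ s r - s θ²/8 is maximal at θ = 4r, with value 2 s r² =
  -- 4 log t. The sign σ selects the tail.
  have hsub : deviation I t p i σ ⊆ ⋃ s ∈ Finset.Ioc 0 t, {h | pullCount h p i = s ∧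
      4 * Real.log t ≤ 4 * √(2 * Real.log t / s) * σ * (rewardSum h p i - I.mean p i * s)
        - s * ((4 * √(2 * Real.log t / s) * σ) ^ 2 / 8)} := by
    rintro h ⟨hn, hd⟩
    simp only [Set.mem_iUnion, Finset.mem_Ioc]
    refine ⟨pullCount h p i, ⟨hn, pullCount_le h p i⟩, rfl, ?_⟩
    have hn' : (0 : ℝ) < pullCount h p i := by exact_mod_cast hn
    set n : ℝ := ((pullCount h p i : ℕ) : ℝ)
    set r := √(2 * Real.log t / n) with hr
    have hr0 : 0 ≤ r := Real.sqrt_nonneg _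
    have hr2 : n * r ^ 2 = 2 * Real.log t := by
      rw [hr, Real.sq_sqrt (by positivity)]
      field_simp
    have := mul_le_mul_of_nonneg_left hd hr0
    have e : n * ((4 * r * σ) ^ 2 / 8) = 2 * (n * r ^ 2) * σ ^ 2 := by ring
    rw [e, hσ, hr2]
    nlinarith
  calc A.law I t (deviation I t p i σ)
      ≤ ∑ s ∈ Finset.Ioc 0 t, ENNReal.ofReal (Real.exp (-(4 * Real.log t))) :=
        (measure_mono hsub).trans ((measure_biUnion_finset_le _ _).trans
          (Finset.sum_le_sum fun s _ => law_deviation_le A I t p i s _ _))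
    _ = ENNReal.ofReal (t * Real.exp (-(4 * Real.log t))) := by
        simp [ENNReal.ofReal_mul]

/-- If UCB-1 pulls a suboptimal arm that it has already pulled often, then one of the confidence
bounds is violated. -/
lemma mem_deviation_of_ucbArm_eq (I : Instance M 2) {t T N : ℕ} (htT : t ≤ T)
    (h : Hist M 2 t) (p : Fin M) {δ : ℝ} (hδ : 0 < δ) (hm : I.mean p 1 + δ ≤ I.mean p 0)
    (hN0 : 0 < N) (hN : 8 * Real.log T / δ ^ 2 ≤ N) (harm : ucbArm h p = 1)
    (hn : N ≤ pullCount h p 1) :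
    h ∈ deviation I t p 0 (-1) ∪ deviation I t p 1 1 := by
  have hle : ucbIndex h p 0 ≤ ucbIndex h p 1 := ((ucbArm_eq_iff h p 1).1 harm).1 0
  have hn1 : 0 < pullCount h p 1 := hN0.trans_le hn
  rw [ucbIndex, ucbIndex, if_neg hn1.ne'] at hle
  have hn0 : 0 < pullCount h p 0 := by
    -- An unpulled arm `0` would have index `⊤`, above the finite index of arm `1`.
    by_contra hc
    rw [if_pos (by omega)] at hle
    exact absurd hle (not_le.2 (EReal.coe_lt_top _))
  rw [if_neg hn0.ne', EReal.coe_le_coe_iff] at hle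
  by_contra hmem
  rw [Set.mem_union, not_or] at hmem
  have hd0 := not_le.1 fun hc => hmem.1 ⟨hn0, hc⟩
  have hd1 := not_le.1 fun hc => hmem.2 ⟨hn1, hc⟩
  have hnN : (N : ℝ) ≤ pullCount h p 1 := by exact_mod_cast hn
  have hn0' : (0 : ℝ) < pullCount h p 0 := by exact_mod_cast hn0
  have hn1' : (0 : ℝ) < pullCount h p 1 := by exact_mod_cast hn1
  set a : ℝ := ((pullCount h p 0 : ℕ) : ℝ)
  set b : ℝ := ((pullCount h p 1 : ℕ) : ℝ)
  have e0 : I.mean p 0 < rewardSum h p 0 / a + √(2 * Real.log t / a) := by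
    rw [← sub_lt_iff_lt_add, lt_div_iff₀ hn0']
    linarith
  have e1 : rewardSum h p 1 / b < I.mean p 1 + √(2 * Real.log t / b) := by
    rw [div_lt_iff₀ hn1']
    linarith
  -- With both confidence bounds valid, arm `1` wins only if twice its radius exceeds the gap;
  -- squaring gives b δ² < 8 log t, contrary to the choice of `N`.
  have e2 : δ / 2 < √(2 * Real.log t / b) := by linarith
  rw [Real.lt_sqrt (by positivity), lt_div_iff₀ hn1'] at e2
  have hlog : Real.log t ≤ Real.log T := by
    rcases Nat.eq_zero_or_pos t with rfl | ht
    · simpa using Real.log_natCast_nonneg T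
    · exact Real.log_le_log (by exact_mod_cast ht) (by exact_mod_cast htT)
  have e3 : 8 * Real.log T ≤ b * δ ^ 2 := by
    rw [div_le_iff₀ (by positivity)] at hN
    exact hN.trans (by gcongr)
  nlinarith

/-- The expected number of pulls of arm `i` by player `p` beyond the first `N`. -/
lemma lintegral_pullCount_sub_le [NeZero K] (I : Instance M K) (p : Fin M) (i : Fin K)
    (N T : ℕ) :
    ∫⁻ h, ((pullCount h p i - N : ℕ) : ENNReal) ∂(indUCB M K).law I T ≤
      ∑ t ∈ Finset.range T, (indUCB M K).law I t {h | ucbArm h p = i ∧ N ≤ pullCount h p i} := by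
  induction T with
  | zero => simp [pullCount_zero]
  | succ T ih =>
    have hmeas : ∀ t, Measurable fun h : Hist M K t =>
        ((pullCount h p i - N : ℕ) : ENNReal) := fun t =>
      (measurable_from_top (f := fun n : ℕ => ((n - N : ℕ) : ENNReal))).comp
        (measurable_pullCount p i)
    have hset : MeasurableSet {h : Hist M K T | ucbArm h p = i ∧ N ≤ pullCount h p i} :=
      (((measurable_pi_apply p).comp measurable_ucbArm) (measurableSet_singleton i)).inter
        (measurable_pullCount p i measurableSet_Ici)
    rw [lintegral_law_succ _ I (hmeas _), Finset.sum_range_succ]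
    calc _ ≤ ∫⁻ h, (((pullCount h p i - N : ℕ) : ENNReal) +
          Set.indicator {h : Hist M K T | ucbArm h p = i ∧ N ≤ pullCount h p i} 1 h)
            ∂(indUCB M K).law I T := lintegral_mono fun h => ?_
      _ = ∫⁻ h, ((pullCount h p i - N : ℕ) : ENNReal) ∂(indUCB M K).law I T +
          (indUCB M K).law I T {h | ucbArm h p = i ∧ N ≤ pullCount h p i} := by
        rw [lintegral_add_left (hmeas _), lintegral_indicator_one hset]
      _ ≤ _ := by gcongr
    rw [lintegral_step _ I h (f := fun x => ((pullCount (extend h x) p i - N : ℕ) : ENNReal))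
      ((hmeas _).comp (measurable_extend.comp measurable_prodMk_left))]
    simp only [pullCount_extend]
    have hpol : (indUCB M K).policy T h = Measure.dirac fun p => ucbArm h p :=
      Kernel.deterministic_apply measurable_ucbArm _
    rw [hpol, lintegral_dirac]
    by_cases ha : ucbArm h p = i
    · by_cases hN : N ≤ pullCount h p i
      · simp only [ha, if_true, lintegral_const, measure_univ, mul_one, Set.indicator,
          Set.mem_ofPred_eq, hN, and_self, Pi.one_apply]
        rw [Nat.sub_add_comm hN]
        push_cast
        rfl
      · simp only [ha, if_true, lintegral_const, measure_univ, mul_one]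
        -- The subtraction is truncated: a pull made while the count is below `N` leaves the excess
        -- at zero.
        rw [Nat.sub_eq_zero_of_le (by omega)]
        simp
    · simp [ha]

/-- For t ≥ 1 the term is t⁻³ ≤ t⁻², and the inverse squares sum to at most 2. The term t = 0
vanishes through its factor t. -/
lemma sum_mul_exp_neg_log_le (T : ℕ) :
    ∑ t ∈ Finset.range T, (t : ℝ) * Real.exp (-(4 * Real.log t)) ≤ 2 := by
  have hsub : Finset.Ioo 0 T ⊆ Finset.range T := fun t ht => by simp at ht ⊢; omega
  rw [← Finset.sum_subset hsub fun t h1 h2 => by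
    have : t = 0 := by simp at h1 h2; omega
    simp [this]]
  have h2 := sum_Ioo_inv_sq_le (α := ℝ) 0 T
  norm_num at h2
  refine le_trans (Finset.sum_le_sum fun t ht => ?_) h2
  have ht1 : (1 : ℝ) ≤ t := by
    have := (Finset.mem_Ioo.1 ht).1
    exact_mod_cast this
  have ht0 : (0 : ℝ) < t := by linarith
  have e : Real.exp (-(4 * Real.log t)) = ((t : ℝ) ^ 4)⁻¹ := by
    rw [Real.exp_neg, show (4 : ℝ) * Real.log t = Real.log ((t : ℝ) ^ 4) by
      rw [Real.log_pow]; norm_num, Real.exp_log (by positivity)]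
  rw [e, ← div_eq_mul_inv, div_le_iff₀ (by positivity)]
  field_simp
  exact ht1

/-- The additive 5 is 1 for rounding up the threshold `N`, plus 2 for the violations at each of the
two arms. -/
lemma integral_pullCount_indUCB_le (I : Instance M 2) (p : Fin M) {δ : ℝ} (hδ : 0 < δ)
    (hm : I.mean p 1 + δ ≤ I.mean p 0) {T : ℕ} (hT : 1 < T) :
    ∫ h, (pullCount h p 1 : ℝ) ∂(indUCB M 2).law I T ≤ 8 * Real.log T / δ ^ 2 + 5 := by
  have hlog : 0 < Real.log T := Real.log_pos (by exact_mod_cast hT)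
  have hx : 0 < 8 * Real.log T / δ ^ 2 := by positivity
  set N := ⌈8 * Real.log T / δ ^ 2⌉₊ with hNdef
  have hN0 : 0 < N := Nat.ceil_pos.2 hx
  have hN1 : (N : ℝ) < 8 * Real.log T / δ ^ 2 + 1 := Nat.ceil_lt_add_one hx.le
  have hdev : ∀ t ∈ Finset.range T, (indUCB M 2).law I t
      {h | ucbArm h p = 1 ∧ N ≤ pullCount h p 1} ≤
        2 * ENNReal.ofReal (t * Real.exp (-(4 * Real.log t))) := by
    intro t ht
    refine (measure_mono fun h hh => mem_deviation_of_ucbArm_eq I (Finset.mem_range.1 ht).le h p hδ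
      hm hN0 (Nat.le_ceil _) hh.1 hh.2).trans ((measure_union_le _ _).trans ?_)
    rw [two_mul]
    exact add_le_add (law_deviation_le_sum _ I t p 0 (by norm_num))
      (law_deviation_le_sum _ I t p 1 (by norm_num))
  have hexc : ∫⁻ h, ((pullCount h p 1 - N : ℕ) : ENNReal) ∂(indUCB M 2).law I T ≤ 4 := by
    refine (lintegral_pullCount_sub_le I p 1 N T).trans ((Finset.sum_le_sum hdev).trans ?_)
    rw [← Finset.mul_sum, ← ENNReal.ofReal_sum_of_nonneg fun t _ => by positivity]
    calc _ ≤ 2 * ENNReal.ofReal 2 := by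
          gcongr
          exact sum_mul_exp_neg_log_le T
      _ = 4 := by norm_num
  have hmeas : Measurable fun h : Hist M 2 T => (pullCount h p 1 : ℝ) :=
    measurable_from_top.comp (measurable_pullCount p 1)
  rw [integral_eq_lintegral_of_nonneg_ae (.of_forall fun h => Nat.cast_nonneg _)
    hmeas.aestronglyMeasurable]
  have hle : ∫⁻ h, ENNReal.ofReal (pullCount h p 1 : ℝ) ∂(indUCB M 2).law I T ≤ N + 4 := by
    calc _ ≤ ∫⁻ h, ((N : ENNReal) + ((pullCount h p 1 - N : ℕ) : ENNReal))
            ∂(indUCB M 2).law I T := by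
          refine lintegral_mono fun h => ?_
          rw [ENNReal.ofReal_natCast]
          rw [← Nat.cast_add]
          exact Nat.cast_le.2 (by omega)
      _ ≤ N + 4 := by
          rw [lintegral_add_left measurable_const, lintegral_const, measure_univ, mul_one]
          gcongr
  have := ENNReal.toReal_mono (by finiteness) hle
  rw [ENNReal.toReal_add (by finiteness) (by finiteness), ENNReal.toReal_natCast,
    ENNReal.toReal_ofNat] at this
  linarith

/-- The regret upper bound for Ind-UCB. -/
theorem regret_indUCB_le {δ : ℝ} (hδ : 0 < δ) (hδ1 : δ ≤ 1) (μ : Fin M → Fin 2 → unitInterval)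
    (h0 : ∀ p, (μ p 0 : ℝ) = 1 / 2 + δ) (h1 : ∀ p, (μ p 1 : ℝ) = 1 / 2) {T : ℕ} (hT : 2 < T) :
    (indUCB M 2).regret (bernoulliInstance μ) T ≤ 13 * (M * Real.log T / δ) := by
  have hT3 : (3 : ℝ) ≤ T := by exact_mod_cast hT
  have hlog : 1 ≤ Real.log T :=
    (Real.le_log_iff_exp_le (by linarith)).2 (Real.exp_one_lt_three.le.trans hT3)
  rw [regret_eq_of_gap _ _ δ (gap_zero_of_means hδ.le μ h0 h1) (gap_one_of_means hδ.le μ h0 h1)]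
  calc ∑ p, δ * ∫ h, (pullCount h p 1 : ℝ) ∂(indUCB M 2).law (bernoulliInstance μ) T
      ≤ ∑ _p : Fin M, 13 * (Real.log T / δ) := Finset.sum_le_sum fun p _ => ?_
    _ = 13 * (M * Real.log T / δ) := by simp; ring
  calc _ ≤ δ * (8 * Real.log T / δ ^ 2 + 5) := by
        gcongr
        refine integral_pullCount_indUCB_le _ p hδ ?_ (by omega)
        rw [bernoulliInstance_mean, bernoulliInstance_mean, h0, h1]
    _ ≤ 13 * (Real.log T / δ) := by
        have e : δ * (8 * Real.log T / δ ^ 2 + 5) = (8 * Real.log T + 5 * δ ^ 2) / δ := by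
          field_simp
        rw [e, ← mul_div_assoc]
        gcongr
        -- The term 5δ² is absorbed into 5 log T, since δ ≤ 1 ≤ log T; hence 13 = 8 + 5.
        nlinarith

end UpperBound

end MPMAB

theorem claim1 :
    (∃ c : ℝ, 0 < c ∧ ∀ C α δ : ℝ, 0 < C → 0 < α → 0 < δ → ∃ T₀ : ℕ,
      ∀ ε : ℝ, 0 < ε → ε < 1 / 8 → δ ≤ ε / 4 →
      ∀ (M : ℕ) (A : ℕ → MPMAB.Algorithm M 2), MPMAB.SublinearRegretWith C α ε A →
      ∀ μ : Fin M → Fin 2 → unitInterval,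
        (∀ p, (μ p 0 : ℝ) = 1 / 2 + δ) → (∀ p, (μ p 1 : ℝ) = 1 / 2) →
      ∀ T : ℕ, max M 2 < T → T₀ ≤ T →
        c * α * (M * Real.log T / δ) ≤ (A T).regret (MPMAB.bernoulliInstance μ) T) ∧
    (∃ c : ℝ, 0 < c ∧ ∀ ε δ : ℝ, 0 < ε → ε < 1 / 8 → 0 < δ → δ ≤ ε / 4 →
      ∀ (M : ℕ) (μ : Fin M → Fin 2 → unitInterval),
        (∀ p, (μ p 0 : ℝ) = 1 / 2 + δ) → (∀ p, (μ p 1 : ℝ) = 1 / 2) →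
      ∀ T : ℕ, max M 2 < T →
        (MPMAB.indUCB M 2).regret (MPMAB.bernoulliInstance μ) T ≤
          c * (M * Real.log T / δ)) := by
  refine ⟨⟨1 / 32, by norm_num, fun C α δ _ hα hδ => ?_⟩, 13, by norm_num, ?_⟩
  · obtain ⟨T₀, hT₀⟩ := MPMAB.regret_lower_bound (C := C) hα hδ
    exact ⟨T₀, fun ε _ => hT₀ ε⟩
  · intro ε δ _ hε hδ hδε M μ h0 h1 T hT
    exact MPMAB.regret_indUCB_le hδ (by linarith) μ h0 h1 ((le_max_right _ _).trans_lt hT)
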